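/- **Setting.** A board $B$ is a finite set of unit tiles (pixels) of $\mathbb Z^2$, two pixels being adjacent if they share a side; its connected components are its regions. For a pixel $p$ let $p^\ell,p^r,p^u,p^d$ be the leftmost/rightmost pixel of its row segment and the topmost/bottommost pixel of its column segment (segments are maximal runs of consecutive pixels in a row or column). A full tilt in one of the four directions moves all particles of a configuration simultaneously as far as possible in that direction, until they are stopped by the boundary or by stopped particles. The move associated with a sink removes the particles located at the sink. A board is *drainable* to its sinks if some sequence of full tilts and sink moves leads from the completely filled board to the empty configuration. In the $3$-scaled board $\boxplus^3 B$ every pixel, and every sink, is replaced by its $3\times 3$ sub-pixels; the move associated with a scaled sink removes the particles at all of its sub-pixels. The *full tilt graph* $G_F$ has the pixels as vertices and the edges $(p,p^x)$, $x\in\{\ell,r,u,d\}$. For a set of sinks $S\subseteq B$, the *large tilt graph* $G_L$ is the subgraph of $G_F$ induced by the following vertices: all pixels reachable in $G_F$ from pixels at convex corners of the boundary; all sinks $s$ and the pixels $s^\ell,s^r,s^u,s^d$; for every reflex corner of the boundary, the ends of the two row segments and of the two column segments that meet there; and all pixels on the intersection of a row segment and a column segment that both contain a pixel listed so far. The *extended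 graph* $\overline{G}$ of a digraph $G$ contains the edges of $G$ with weight $0$, for every edge $(p,q)$ of $G$ such that $(q,p)$ is not an edge the *inverse edge* $(q,p)$ with weight $1$, and edges $(s,r)$ of weight $0$ from all sinks $s$ to a new root vertex $r$. **Algorithm 1 (scaling factor 3).** Input: a board $B$ and a set $S\subseteq B$ such that every region of $B$ contains an element of $S$. Compute a minimum-weight spanning arborescence $T$ of $\overline{G_L}$ converging to $r$. For every inverse edge $(q,p)$ in $T$, place two obstacles in the $3\times3$ block of $p$: the top-middle and bottom-middle sub-pixels if the edge is horizontal, the middle-left and middle-right sub-pixels if it is vertical. Return the set of all obstacles placed. **Theorem.** Let $B$ be a board and $S\subseteq B$ such that every region of $B$ contains an element of $S$. Then a minimum-weight arborescence as required by Algorithm 1 exists, and for every choice of it Algorithm 1 with scaling factor $3$ places at most $4\,|\mathrm{OPT}|$ obstacles, where $|\mathrm{OPT}|$ is the minimum size of a set $O$ of sub-pixels such that $\boxplus^3 B$ without $O$ is drainable to the scaled sinks. -/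

import Mathlib

namespace TiltBoard

/-! ### Boards, directions, tilts -/

/-- Pixels (tiles of the square tiling), given by integer coordinates. -/
abbrev Pixel : Type := ℤ × ℤ

/-- The four directions of motion. -/
inductive Direction : Type
  | left
  | right
  | up
  | down
  deriving DecidableEq

instance : Fintype Direction where
  elems := {.left, .right, .up, .down}
  complete := by intro d; cases d <;> decide

/-- The unit vector of a direction. -/
def Direction.vec : Direction → Pixel
  | .left => (-1, 0)
  | .right => (1, 0)
  | .up => (0, 1)
  | .down => (0, -1)

/-- A board is given by its finite set of pixels `B`; two pixels of the board are adjacent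
if they share a side. -/
def Adj (B : Finset Pixel) (p q : Pixel) : Prop :=
  p ∈ B ∧ q ∈ B ∧ ∃ d : Direction, q = p + d.vec

/-- Every region (connected component) of the board `B` contains a pixel of `S`. -/
def EveryRegionHasSink (B S : Finset Pixel) : Prop :=
  ∀ p ∈ B, ∃ s ∈ S, Relation.ReflTransGen (Adj B) p s

/-- The number of pixels ahead of the pixel `p` of `B` in direction `d` in its segment, i.e. the
greatest `j` such that `p, p + d, …, p + j d` all belong to `B` (such a `j` is less
than the number of pixels of `B`). -/
def tiltDist (B : Finset Pixel) (d : Direction) (p : Pixel) : ℕ :=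
  Nat.findGreatest (fun j => ∀ i ≤ j, p + i • d.vec ∈ B) B.card

/-- The last pixel in direction `d` in the segment of `p`: the position at which a single particle
starting at `p` comes to rest after a full tilt in direction `d`. For the four directions these
are the pixels `p^ℓ, p^r, p^u, p^d`. -/
def tiltEnd (B : Finset Pixel) (d : Direction) (p : Pixel) : Pixel :=
  p + tiltDist B d p • d.vec

/-! ### Full tilt moves of configurations, and draining -/

/-- The number of pixels ahead of `p` in direction `d` in its segment that are not occupied in the
configuration `C`. -/
def emptyAhead (B : Finset Pixel) (d : Direction) (C : Finset Pixel) (p : Pixel) : ℕ :=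
  ((Finset.Icc 1 (tiltDist B d p)).filter (fun j => p + j • d.vec ∉ C)).card

/-- The full tilt move in direction `d`: all particles of the configuration `C` move
simultaneously in direction `d` as far as possible, being stopped by the boundary of the board
and by particles that have been stopped. So a particle advances by the number of
unoccupied pixels ahead of it in its segment. -/
def fullTilt (B : Finset Pixel) (d : Direction) (C : Finset Pixel) : Finset Pixel :=
  C.image (fun p => p + emptyAhead B d C p • d.vec)

/-- One move on the board `B`: a full tilt, or the move associated with a sink. A sink is
a set of pixels; its move removes all particles located at these pixels. -/
inductive Move (B : Finset Pixel) (sinks : Finset (Finset Pixel)) :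
    Finset Pixel → Finset Pixel → Prop
  | tilt (C : Finset Pixel) (d : Direction) : Move B sinks C (fullTilt B d C)
  | drain (C : Finset Pixel) (s : Finset Pixel) (hs : s ∈ sinks) : Move B sinks C (C \ s)

/-- The board `B` is drainable: some sequence of moves leads from the completely filled board
to the empty configuration. -/
def Drainable (B : Finset Pixel) (sinks : Finset (Finset Pixel)) : Prop :=
  Relation.ReflTransGen (Move B sinks) B ∅

/-! ### Scaling and obstacle placements -/

/-- The `k ^ 2` sub-pixels of the pixel `p`. -/
def subPixels (k : ℕ) (p : Pixel) : Finset Pixel :=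
  (Finset.range k ×ˢ Finset.range k).image
    (fun ij => ((k : ℤ) * p.1 + (ij.1 : ℤ), (k : ℤ) * p.2 + (ij.2 : ℤ)))

/-- The `k`-scaled board. -/
def scaledBoard (k : ℕ) (B : Finset Pixel) : Finset Pixel :=
  B.biUnion (subPixels k)

/-- The sinks of the `k`-scaled board: every sink is scaled to the set of its sub-pixels. -/
def scaledSinks (k : ℕ) (S : Finset Pixel) : Finset (Finset Pixel) :=
  S.image (subPixels k)

/-- `O` is a set of sub-pixels such that the `k`-scaled board without `O` is drainable to the
(scaled) sinks `S`. -/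
def IsFeasible (k : ℕ) (B S O : Finset Pixel) : Prop :=
  O ⊆ scaledBoard k B ∧ Drainable (scaledBoard k B \ O) (scaledSinks k S)

/-- The number of obstacles in an optimum solution for the `k`-scaled board. -/
noncomputable def optimum (k : ℕ) (B S : Finset Pixel) : ℕ :=
  sInf {n : ℕ | ∃ O : Finset Pixel, IsFeasible k B S O ∧ O.card = n}

/-- The optimum is attained: there always is a feasible placement, as the board may be filled
with obstacles. -/
theorem exists_optimum (k : ℕ) (B S : Finset Pixel) :
    ∃ O : Finset Pixel, IsFeasible k B S O ∧ O.card = optimum k B S := by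
  refine Nat.sInf_mem
    (s := {n : ℕ | ∃ O : Finset Pixel, IsFeasible k B S O ∧ O.card = n}) ?_
  refine ⟨_, scaledBoard k B, ⟨subset_rfl, ?_⟩, rfl⟩
  rw [Finset.sdiff_self]
  exact Relation.ReflTransGen.refl

/-! ### Directed graphs, extended graphs, arborescences -/

/-- A finite directed graph. -/
structure FinDigraph (α : Type) where
  verts : Finset α
  edges : Finset (α × α)
  edges_subset : edges ⊆ verts ×ˢ verts

/-- The inverse edges of `G`: the pairs `(q, p)` with `(p, q)` an edge and `(q, p)` not an edge. -/
def FinDigraph.inverseEdges {α : Type} [DecidableEq α] (G : FinDigraph α) : Finset (α × α) :=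
  (G.edges.image Prod.swap).filter (fun e => e ∉ G.edges)

/-- The edges of the extended graph of `G` for the set `S` of sinks. Its vertices are the `some v`
with `v` a vertex of `G`, and the root `none`. -/
def FinDigraph.extEdges {α : Type} [DecidableEq α] (G : FinDigraph α) (S : Finset α) :
    Finset (Option α × Option α) :=
  (G.edges ∪ G.inverseEdges).image (fun e => (some e.1, some e.2)) ∪
    S.image (fun s => (some s, none))

/-- The weight of an edge of the extended graph: one for inverse edges, zero for the others. -/
def FinDigraph.extWeight {α : Type} [DecidableEq α] (G : FinDigraph α)
    (e : Option α × Option α) : ℕ :=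
  if e ∈ G.inverseEdges.image (fun f => (some f.1, some f.2)) then 1 else 0

/-- The total weight of a set of edges of the extended graph. -/
def FinDigraph.totalWeight {α : Type} [DecidableEq α] (G : FinDigraph α)
    (T : Finset (Option α × Option α)) : ℕ :=
  ∑ e ∈ T, G.extWeight e

/-- `T` is the edge set of a (spanning) arborescence of the extended graph that converges
to the root: every vertex other than the root has exactly one outgoing edge in `T`, and
the root can be reached along `T` from every vertex. (No edge leaves the root.) -/
def FinDigraph.IsArborescence {α : Type} [DecidableEq α] (G : FinDigraph α) (S : Finset α)
    (T : Finset (Option α × Option α)) : Prop :=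
  T ⊆ G.extEdges S ∧
  (∀ v ∈ G.verts, ∃! w : Option α, (some v, w) ∈ T) ∧
  ∀ v ∈ G.verts, Relation.ReflTransGen (fun a b => (a, b) ∈ T) (some v) none

/-- `T` is a minimum-weight arborescence of the extended graph. -/
def FinDigraph.IsMinArborescence {α : Type} [DecidableEq α] (G : FinDigraph α) (S : Finset α)
    (T : Finset (Option α × Option α)) : Prop :=
  G.IsArborescence S T ∧
    ∀ T' : Finset (Option α × Option α), G.IsArborescence S T' →
      G.totalWeight T ≤ G.totalWeight T'

/-! ### Tilt graphs -/

/-- The full tilt graph of `B`: its vertices are all pixels, and its edges lead from every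
pixel `p` to `p^ℓ`, `p^r`, `p^u` and `p^d`. -/
def fullTiltGraph (B : Finset Pixel) : FinDigraph Pixel where
  verts := B
  edges := (B ×ˢ B).filter (fun e => ∃ d : Direction, e.2 = tiltEnd B d e.1)
  edges_subset := Finset.filter_subset _ _

/-- The subgraph of `G` induced by the vertices in `U`. -/
def FinDigraph.induce {α : Type} [DecidableEq α] (G : FinDigraph α) (U : Finset α) :
    FinDigraph α where
  verts := G.verts ∩ U
  edges := G.edges.filter (fun e => e.1 ∈ U ∧ e.2 ∈ U)
  edges_subset := by
    intro e he
    obtain ⟨h, h1, h2⟩ := Finset.mem_filter.1 he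
    obtain ⟨h3, h4⟩ := Finset.mem_product.1 (G.edges_subset h)
    exact Finset.mem_product.2 ⟨Finset.mem_inter.2 ⟨h3, h1⟩, Finset.mem_inter.2 ⟨h4, h2⟩⟩

/-- `p` is a corner pixel: it lies at a convex corner of the boundary, i.e. it lacks a horizontal
and a vertical neighbor. -/
def IsCornerPixel (B : Finset Pixel) (p : Pixel) : Prop :=
  p ∈ B ∧ (p + Direction.left.vec ∉ B ∨ p + Direction.right.vec ∉ B) ∧
    (p + Direction.up.vec ∉ B ∨ p + Direction.down.vec ∉ B)

/-- The vertices of the small tilt graph: the pixels that can be reached in the full tilt graph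
from corner pixels. -/
def InSmallTiltGraph (B : Finset Pixel) (p : Pixel) : Prop :=
  ∃ c : Pixel, IsCornerPixel B c ∧
    Relation.ReflTransGen (fun a b => (a, b) ∈ (fullTiltGraph B).edges) c p

/-- The four tiles meeting at the lattice point which is the lower-left corner of the tile `c`. -/
def tilesAround (c : Pixel) : Finset Pixel :=
  {c, c + (-1, 0), c + (0, -1), c + (-1, -1)}

/-- The lower-left corner of the tile `c` is a reflex corner of the boundary: exactly three of the
four tiles around it belong to the board. -/
def IsReflexCorner (B : Finset Pixel) (c : Pixel) : Prop :=
  (tilesAround c ∩ B).card = 3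

/-- `p` is an end of one of the two row segments or of one of the two column segments
that meet at some reflex corner; these are the segments containing a pixel at the corner. -/
def IsReflexEnd (B : Finset Pixel) (p : Pixel) : Prop :=
  ∃ c : Pixel, IsReflexCorner B c ∧ ∃ a ∈ tilesAround c ∩ B, ∃ d : Direction, p = tiltEnd B d a

/-- `p` and `q` lie in the same row segment of `B`. -/
def SameRowSegment (B : Finset Pixel) (p q : Pixel) : Prop :=
  p.2 = q.2 ∧ ∀ x ∈ Set.uIcc p.1 q.1, (x, p.2) ∈ B

/-- `p` and `q` lie in the same column segment of `B`. -/
def SameColumnSegment (B : Finset Pixel) (p q : Pixel) : Prop :=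
  p.1 = q.1 ∧ ∀ y ∈ Set.uIcc p.2 q.2, (p.1, y) ∈ B

/-- The pixels included initially in the large tilt graph: the vertices of the small tilt graph,
the sinks `s` with their pixels `s^ℓ, s^r, s^u, s^d`, and the ends of the segments at
reflex corners. -/
def IsIncluded (B S : Finset Pixel) (p : Pixel) : Prop :=
  InSmallTiltGraph B p ∨ p ∈ S ∨ (∃ s ∈ S, ∃ d : Direction, p = tiltEnd B d s) ∨ IsReflexEnd B p

open Classical in
/-- The vertices of the large tilt graph: the included pixels, and all pixels on intersections of
row segments and column segments containing an included pixel. -/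
noncomputable def largeTiltVerts (B S : Finset Pixel) : Finset Pixel :=
  B.filter (fun p => IsIncluded B S p ∨
    ((∃ a, IsIncluded B S a ∧ SameRowSegment B p a) ∧
      ∃ b, IsIncluded B S b ∧ SameColumnSegment B p b))

/-- The large tilt graph of `B` with set of sinks `S`. -/
noncomputable def largeTiltGraph (B S : Finset Pixel) : FinDigraph Pixel :=
  (fullTiltGraph B).induce (largeTiltVerts B S)

/-! ### The algorithm, for scaling factor 3 -/

/-- The two obstacles of the turn gadget determined by the inverse edge `e = (q, p)`, placed at
sub-pixels of the head `p` in the 3-scaled board: for a horizontal edge the lower and the upper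
sub-pixel in the middle column of `p`, for a vertical edge the left and the right sub-pixel
in the middle row of `p`. -/
def turnGadget (e : Pixel × Pixel) : Finset Pixel :=
  if e.1.2 = e.2.2 then
    {(3 * e.2.1 + 1, 3 * e.2.2), (3 * e.2.1 + 1, 3 * e.2.2 + 2)}
  else
    {(3 * e.2.1, 3 * e.2.2 + 1), (3 * e.2.1 + 2, 3 * e.2.2 + 1)}

/-- The obstacles placed for the arborescence `T` of the extended graph of `G`: those of the turn
gadgets determined by the inverse edges in `T`. -/
def placedObstacles (G : FinDigraph Pixel) (T : Finset (Option Pixel × Option Pixel)) :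
    Finset Pixel :=
  (G.inverseEdges.filter (fun e => (some e.1, some e.2) ∈ T)).biUnion turnGadget

/-- `O` is a possible output of the algorithm for the board `B`, the sinks `S` and scaling factor 3:
the obstacles placed for some minimum-weight arborescence of the extended large tilt graph. -/
def IsAlgorithmOutput (B S O : Finset Pixel) : Prop :=
  ∃ T : Finset (Option Pixel × Option Pixel),
    (largeTiltGraph B S).IsMinArborescence S T ∧ O = placedObstacles (largeTiltGraph B S) T

end TiltBoard

namespace TiltBoard

/-! ### Ends of segments -/

/-! The core is a lower bound: for every feasible `O`, some arborescence has weight at most `2 *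
O.card`. A minimum arborescence then has at most this weight too, and each of its inverse edges
places at most two obstacles, which gives the factor 4.

For the lower bound, `rep` maps every pixel to a vertex of the large tilt graph so that segments go
to segments and a missing neighbour stays missing (`tiltEnd_rep_congr`, `rep_add_notMem`). This
works because neighbouring segments whose shapes differ meet at a reflex corner, so pixels are only
moved across segments of equal shape. A tilt on the scaled board keeps a particle in one segment of
`B`. If that segment is free of obstacles, the tilt becomes an edge of the large tilt graph;
otherwise it becomes an edge followed by an inverse edge along the image of the segment
(`keyedEdge_reach_of_tilt`).

Since `O` drains the board, every vertex therefore reaches a sink using inverse edges only along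
images of blocked segments. There are at most `2 * O.card` of these, as an obstacle lies over one
row segment and one column segment. Finally, one inverse edge per such segment suffices
(`exists_few_edges`), because the tails of inverse edges along a common segment are ends of it and
are joined by ordinary edges. -/

theorem Direction.vec_injective_smul (d : Direction) {i j : ℕ} (h : i • d.vec = j • d.vec) :
    i = j := by
  cases d <;> simp [Direction.vec] at h <;> exact h

/-- The pixels ahead are distinct, so the search bound `B.card` in `tiltDist` never cuts a segment
short. -/
theorem lt_card_of_ahead {B : Finset Pixel} {d : Direction} {p : Pixel} {j : ℕ}
    (h : ∀ i ≤ j, p + i • d.vec ∈ B) : j < B.card := by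
  have h1 : (Finset.range (j + 1)).card ≤ B.card := by
    refine Finset.card_le_card_of_injOn (fun i => p + i • d.vec) ?_ ?_
    · intro i hi
      exact h i (by simpa [Nat.lt_succ_iff] using hi)
    · intro a _ b _ hab
      exact d.vec_injective_smul (add_left_cancel hab)
  simpa using h1

theorem add_smul_mem_of_le_tiltDist {B : Finset Pixel} (d : Direction) {p : Pixel} (hp : p ∈ B)
    {i : ℕ} (hi : i ≤ tiltDist B d p) : p + i • d.vec ∈ B := by
  have := Nat.findGreatest_spec (P := fun j => ∀ i ≤ j, p + i • d.vec ∈ B) (m := 0)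
    (n := B.card) (Nat.zero_le _) (by simpa using hp)
  exact this i hi

theorem tiltDist_eq {B : Finset Pixel} {d : Direction} {p : Pixel} {n : ℕ}
    (h : ∀ i ≤ n, p + i • d.vec ∈ B) (h' : p + (n + 1) • d.vec ∉ B) : tiltDist B d p = n := by
  apply le_antisymm
  · by_contra hc
    exact h' (add_smul_mem_of_le_tiltDist d (by simpa using h 0 (Nat.zero_le _)) (by omega))
  · exact Nat.le_findGreatest (lt_card_of_ahead h).le h

theorem add_succ_tiltDist_notMem {B : Finset Pixel} (d : Direction) {p : Pixel} (hp : p ∈ B) :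
    p + (tiltDist B d p + 1) • d.vec ∉ B := by
  intro h
  have h1 : ∀ i ≤ tiltDist B d p + 1, p + i • d.vec ∈ B := by
    intro i hi
    rcases Nat.lt_or_ge i (tiltDist B d p + 1) with h2 | h2
    · exact add_smul_mem_of_le_tiltDist d hp (by omega)
    · obtain rfl : i = tiltDist B d p + 1 := by omega
      exact h
  have := Nat.le_findGreatest (P := fun j => ∀ i ≤ j, p + i • d.vec ∈ B)
    (lt_card_of_ahead h1).le h1
  change _ ≤ tiltDist B d p at this
  omega

theorem tiltEnd_mem {B : Finset Pixel} (d : Direction) {p : Pixel} (hp : p ∈ B) :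
    tiltEnd B d p ∈ B := add_smul_mem_of_le_tiltDist d hp le_rfl

theorem tiltEnd_add_notMem {B : Finset Pixel} (d : Direction) {p : Pixel} (hp : p ∈ B) :
    tiltEnd B d p + d.vec ∉ B := by
  have := add_succ_tiltDist_notMem d hp
  rwa [succ_nsmul, ← add_assoc] at this

theorem tiltDist_of_notMem {B : Finset Pixel} {d : Direction} {p : Pixel} (hp : p ∈ B)
    (h : p + d.vec ∉ B) : tiltDist B d p = 0 :=
  tiltDist_eq (by simpa using hp) (by simpa using h)

theorem tiltEnd_of_notMem {B : Finset Pixel} {d : Direction} {p : Pixel} (hp : p ∈ B)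
    (h : p + d.vec ∉ B) : tiltEnd B d p = p := by
  simp [tiltEnd, tiltDist_of_notMem hp h]

theorem tiltDist_step {B : Finset Pixel} {d : Direction} {p : Pixel} (hp : p ∈ B)
    (h : p + d.vec ∈ B) : tiltDist B d p = tiltDist B d (p + d.vec) + 1 := by
  refine tiltDist_eq ?_ ?_
  · rintro (_ | i) hi
    · simpa using hp
    · have := add_smul_mem_of_le_tiltDist d h (i := i) (by omega)
      rwa [add_assoc, ← succ_nsmul'] at this
  · have := add_succ_tiltDist_notMem d h
    rwa [add_assoc, ← succ_nsmul'] at this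

theorem tiltEnd_step {B : Finset Pixel} {d : Direction} {p : Pixel} (hp : p ∈ B)
    (h : p + d.vec ∈ B) : tiltEnd B d (p + d.vec) = tiltEnd B d p := by
  rw [tiltEnd, tiltEnd, tiltDist_step hp h, succ_nsmul', add_assoc]

theorem tilt_induction {B : Finset Pixel} {d : Direction} {P : Pixel → Prop}
    (step : ∀ z ∈ B, z + d.vec ∈ B → P z → P (z + d.vec)) {p : Pixel} (hp : p ∈ B) (h : P p) :
    P (tiltEnd B d p) := by
  have : ∀ i ≤ tiltDist B d p, P (p + i • d.vec) := by
    intro i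
    induction i with
    | zero => intro _; simpa using h
    | succ i ih =>
      intro hi
      have h1 := add_smul_mem_of_le_tiltDist d hp hi
      rw [succ_nsmul, ← add_assoc] at h1 ⊢
      exact step _ (add_smul_mem_of_le_tiltDist d hp (by omega)) h1 (ih (by omega))
  exact this _ le_rfl

/-- The opposite direction. -/
def Direction.opp : Direction → Direction
  | .left => .right
  | .right => .left
  | .up => .down
  | .down => .up

@[simp] theorem Direction.vec_opp (d : Direction) : d.opp.vec = -d.vec := by cases d <;> rfl

theorem tiltEnd_opp_step {B : Finset Pixel} {d : Direction} {p : Pixel} (hp : p ∈ B)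
    (h : p + d.vec ∈ B) : tiltEnd B d.opp (p + d.vec) = tiltEnd B d.opp p := by
  have := tiltEnd_step (d := d.opp) h (by simpa using hp)
  simpa using this.symm

theorem tiltEnd_tiltEnd {B : Finset Pixel} (d : Direction) {p : Pixel} (hp : p ∈ B) :
    tiltEnd B d (tiltEnd B d p) = tiltEnd B d p :=
  tiltEnd_of_notMem (tiltEnd_mem d hp) (tiltEnd_add_notMem d hp)

theorem tiltEnd_opp_tiltEnd {B : Finset Pixel} (d : Direction) {p : Pixel} (hp : p ∈ B) :
    tiltEnd B d.opp (tiltEnd B d p) = tiltEnd B d.opp p :=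
  tilt_induction (P := fun z => tiltEnd B d.opp z = tiltEnd B d.opp p)
    (fun _ hz hz' h => (tiltEnd_opp_step hz hz').trans h) hp rfl

theorem tiltEnd_opp_congr {B : Finset Pixel} {d : Direction} {p q : Pixel} (hp : p ∈ B)
    (hq : q ∈ B) (h : tiltEnd B d p = tiltEnd B d q) :
    tiltEnd B d.opp p = tiltEnd B d.opp q := by
  rw [← tiltEnd_opp_tiltEnd d hp, ← tiltEnd_opp_tiltEnd d hq, h]

/-- The direction `right` for horizontal directions, and `up` for vertical ones. -/
def Direction.axis : Direction → Direction
  | .left => .right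
  | .right => .right
  | .up => .up
  | .down => .up

/-- A segment is determined by either of its ends. Hence "same segment" can be expressed throughout
as equality of `tiltEnd`, in whichever direction along the axis is convenient. -/
theorem tiltEnd_axis_congr {B : Finset Pixel} {d e : Direction} (hde : d.axis = e.axis)
    {p q : Pixel} (hp : p ∈ B) (hq : q ∈ B) (h : tiltEnd B d p = tiltEnd B d q) :
    tiltEnd B e p = tiltEnd B e q := by
  have h1 := tiltEnd_opp_congr hp hq h
  cases d <;> cases e <;> first | exact h | exact h1 | cases hde

theorem tiltEnd_step_of_axis {B : Finset Pixel} {d e : Direction} (hde : d.axis = e.axis)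
    {p : Pixel} (hp : p ∈ B) (h : p + d.vec ∈ B) :
    tiltEnd B e (p + d.vec) = tiltEnd B e p :=
  tiltEnd_axis_congr hde h hp (tiltEnd_step hp h)

theorem tiltEnd_tiltEnd_of_axis {B : Finset Pixel} {d e : Direction} (hde : d.axis = e.axis)
    {p : Pixel} (hp : p ∈ B) : tiltEnd B e (tiltEnd B d p) = tiltEnd B e p :=
  tiltEnd_axis_congr hde (tiltEnd_mem d hp) hp (tiltEnd_tiltEnd d hp)

/-! ### Segments as intervals of coordinates -/

theorem tiltEnd_right_spec {B : Finset Pixel} {p : Pixel} (hp : p ∈ B) :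
    (tiltEnd B .right p).2 = p.2 ∧ p.1 ≤ (tiltEnd B .right p).1 ∧
      ∀ x, p.1 ≤ x → x ≤ (tiltEnd B .right p).1 → (x, p.2) ∈ B := by
  refine ⟨by simp [tiltEnd, Direction.vec], by simp [tiltEnd, Direction.vec], fun x h1 h2 => ?_⟩
  have := add_smul_mem_of_le_tiltDist (B := B) .right hp (i := (x - p.1).toNat)
    (by simp [tiltEnd, Direction.vec] at h2; omega)
  convert this using 1
  ext <;> (simp [Direction.vec]; try omega)

theorem tiltEnd_up_spec {B : Finset Pixel} {p : Pixel} (hp : p ∈ B) :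
    (tiltEnd B .up p).1 = p.1 ∧ p.2 ≤ (tiltEnd B .up p).2 ∧
      ∀ y, p.2 ≤ y → y ≤ (tiltEnd B .up p).2 → (p.1, y) ∈ B := by
  refine ⟨by simp [tiltEnd, Direction.vec], by simp [tiltEnd, Direction.vec], fun x h1 h2 => ?_⟩
  have := add_smul_mem_of_le_tiltDist (B := B) .up hp (i := (x - p.2).toNat)
    (by simp [tiltEnd, Direction.vec] at h2; omega)
  convert this using 1
  ext <;> (simp [Direction.vec]; try omega)

theorem tiltEnd_add_smul {B : Finset Pixel} {d : Direction} {p : Pixel} {n : ℕ}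
    (h : ∀ i ≤ n, p + i • d.vec ∈ B) : tiltEnd B d (p + n • d.vec) = tiltEnd B d p := by
  induction n with
  | zero => simp
  | succ n ih =>
    have h1 := h (n + 1) le_rfl
    rw [succ_nsmul, ← add_assoc] at h1 ⊢
    rw [tiltEnd_step (h n (by omega)) h1, ih fun i hi => h i (by omega)]

theorem sameRowSegment_iff {B : Finset Pixel} {p q : Pixel} :
    SameRowSegment B p q ↔ p ∈ B ∧ q ∈ B ∧ tiltEnd B .right p = tiltEnd B .right q := by
  have key : ∀ p q : Pixel, p.2 = q.2 → p.1 ≤ q.1 → (∀ x ∈ Set.Icc p.1 q.1, (x, p.2) ∈ B) →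
      tiltEnd B .right q = tiltEnd B .right p := by
    intro p q h1 h2 h
    have := tiltEnd_add_smul (B := B) (d := .right) (p := p) (n := (q.1 - p.1).toNat) ?_
    · rw [← this]
      congr 1
      ext <;> (simp [Direction.vec]; try omega)
    · intro i hi
      have := h (p.1 + i) ⟨by omega, by omega⟩
      convert this using 1
      ext <;> simp [Direction.vec]
  constructor
  · rintro ⟨h1, h2⟩
    have hp : p ∈ B := h2 p.1 Set.left_mem_uIcc
    have hq : q ∈ B := by rw [show q = (q.1, p.2) by rw [h1]]; exact h2 q.1 Set.right_mem_uIcc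
    refine ⟨hp, hq, ?_⟩
    rcases le_total p.1 q.1 with h | h
    · exact (key p q h1 h (by rwa [Set.uIcc_of_le h] at h2)).symm
    · exact key q p h1.symm h (by rwa [Set.uIcc_of_ge h, h1] at h2)
  · rintro ⟨hp, hq, h⟩
    obtain ⟨a1, a2, a3⟩ := tiltEnd_right_spec hp
    obtain ⟨b1, b2, b3⟩ := tiltEnd_right_spec hq
    have h1 : p.2 = q.2 := by rw [← a1, ← b1, h]
    rw [← h] at b2 b3
    refine ⟨h1, fun x hx => ?_⟩
    rw [Set.mem_uIcc] at hx
    rcases hx with hx | hx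
    · exact a3 x hx.1 (hx.2.trans b2)
    · rw [h1]; exact b3 x hx.1 (hx.2.trans a2)

theorem sameColumnSegment_iff {B : Finset Pixel} {p q : Pixel} :
    SameColumnSegment B p q ↔ p ∈ B ∧ q ∈ B ∧ tiltEnd B .up p = tiltEnd B .up q := by
  have key : ∀ p q : Pixel, p.1 = q.1 → p.2 ≤ q.2 → (∀ y ∈ Set.Icc p.2 q.2, (p.1, y) ∈ B) →
      tiltEnd B .up q = tiltEnd B .up p := by
    intro p q h1 h2 h
    have := tiltEnd_add_smul (B := B) (d := .up) (p := p) (n := (q.2 - p.2).toNat) ?_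
    · rw [← this]
      congr 1
      ext <;> (simp [Direction.vec]; try omega)
    · intro i hi
      have := h (p.2 + i) ⟨by omega, by omega⟩
      convert this using 1
      ext <;> simp [Direction.vec]
  constructor
  · rintro ⟨h1, h2⟩
    have hp : p ∈ B := h2 p.2 Set.left_mem_uIcc
    have hq : q ∈ B := by rw [show q = (p.1, q.2) by rw [h1]]; exact h2 q.2 Set.right_mem_uIcc
    refine ⟨hp, hq, ?_⟩
    rcases le_total p.2 q.2 with h | h
    · exact (key p q h1 h (by rwa [Set.uIcc_of_le h] at h2)).symm
    · exact key q p h1.symm h (by rwa [Set.uIcc_of_ge h, h1] at h2)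
  · rintro ⟨hp, hq, h⟩
    obtain ⟨a1, a2, a3⟩ := tiltEnd_up_spec hp
    obtain ⟨b1, b2, b3⟩ := tiltEnd_up_spec hq
    have h1 : p.1 = q.1 := by rw [← a1, ← b1, h]
    rw [← h] at b2 b3
    refine ⟨h1, fun x hx => ?_⟩
    rw [Set.mem_uIcc] at hx
    rcases hx with hx | hx
    · exact a3 x hx.1 (hx.2.trans b2)
    · rw [h1]; exact b3 x hx.1 (hx.2.trans a2)

/-! ### Marked segments -/

/-- The segment of `p` in direction `d` contains an included pixel. -/
def Marked (B S : Finset Pixel) (d : Direction) (p : Pixel) : Prop :=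
  ∃ a ∈ B, IsIncluded B S a ∧ tiltEnd B d a = tiltEnd B d p

theorem Marked.congr {B S : Finset Pixel} {d : Direction} {p q : Pixel} (h : Marked B S d p)
    (hpq : tiltEnd B d p = tiltEnd B d q) : Marked B S d q := by
  obtain ⟨a, h1, h2, h3⟩ := h
  exact ⟨a, h1, h2, h3.trans hpq⟩

theorem marked_of_included_tiltEnd {B S : Finset Pixel} {d : Direction} {p : Pixel} (hp : p ∈ B)
    (h : IsIncluded B S (tiltEnd B d p)) : Marked B S d p :=
  ⟨_, tiltEnd_mem d hp, h, tiltEnd_tiltEnd d hp⟩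

/-- Lets the reflex-corner arguments run for all four orientations at once, although
`IsReflexCorner` refers to a lower-left corner. -/
theorem tilesAround_eq (p : Pixel) (d e : Direction) (hde : d.axis ≠ e.axis) :
    ∃ c, tilesAround c = {p, p + d.vec, p + e.vec, p + d.vec + e.vec} := by
  obtain ⟨x, y⟩ := p
  cases d <;> cases e <;> first
    | exact absurd rfl hde
    | (refine ⟨(x, y), ?_⟩; ext ⟨a, b⟩
       simp only [tilesAround, Direction.vec, Finset.mem_insert, Finset.mem_singleton,
         Prod.mk_add_mk, Prod.mk.injEq]; omega)
    | (refine ⟨(x + 1, y), ?_⟩; ext ⟨a, b⟩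
       simp only [tilesAround, Direction.vec, Finset.mem_insert, Finset.mem_singleton,
         Prod.mk_add_mk, Prod.mk.injEq]; omega)
    | (refine ⟨(x, y + 1), ?_⟩; ext ⟨a, b⟩
       simp only [tilesAround, Direction.vec, Finset.mem_insert, Finset.mem_singleton,
         Prod.mk_add_mk, Prod.mk.injEq]; omega)
    | (refine ⟨(x + 1, y + 1), ?_⟩; ext ⟨a, b⟩
       simp only [tilesAround, Direction.vec, Finset.mem_insert, Finset.mem_singleton,
         Prod.mk_add_mk, Prod.mk.injEq]; omega)

theorem Direction.vec_ne_zero (d : Direction) : d.vec ≠ 0 := by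
  cases d <;> simp [Direction.vec]

theorem Direction.vec_add_ne_zero {d e : Direction} (h : d.axis ≠ e.axis) :
    d.vec + e.vec ≠ 0 := by
  cases d <;> cases e <;> first | exact absurd rfl h | simp [Direction.vec]

theorem Direction.vec_ne {d e : Direction} (h : d.axis ≠ e.axis) : d.vec ≠ e.vec := by
  cases d <;> cases e <;> first | exact absurd rfl h | simp [Direction.vec]

theorem marked_of_reflexCorner {B S : Finset Pixel} {c p : Pixel} (hc : IsReflexCorner B c)
    (hpc : p ∈ tilesAround c) (hp : p ∈ B) (x : Direction) : Marked B S x p :=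
  marked_of_included_tiltEnd hp
    (.inr (.inr (.inr ⟨c, hc, p, Finset.mem_inter.2 ⟨hpc, hp⟩, x, rfl⟩)))

theorem marked_of_missing_side {B S : Finset Pixel} {p : Pixel} {d e : Direction}
    (hde : d.axis ≠ e.axis) (hp : p ∈ B) (hd : p + d.vec ∉ B) (he : p + e.vec ∈ B)
    (h : p + d.vec + e.vec ∈ B) (x : Direction) : Marked B S x p := by
  obtain ⟨c, hc⟩ := tilesAround_eq p d e hde
  refine marked_of_reflexCorner (c := c) ?_ (by simp [hc]) hp x
  rw [IsReflexCorner, hc, Finset.insert_inter_of_mem hp, Finset.insert_inter_of_notMem hd,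
    Finset.insert_inter_of_mem he, Finset.singleton_inter_of_mem h]
  have := d.vec_ne_zero
  have := e.vec_ne_zero
  have := Direction.vec_add_ne_zero hde
  refine Finset.card_eq_three.2 ⟨_, _, _, ?_, ?_, ?_, rfl⟩ <;> simp_all [add_assoc]

theorem marked_of_missing_diagonal {B S : Finset Pixel} {p : Pixel} {d e : Direction}
    (hde : d.axis ≠ e.axis) (hp : p ∈ B) (hd : p + d.vec ∈ B) (he : p + e.vec ∈ B)
    (h : p + d.vec + e.vec ∉ B) (x : Direction) : Marked B S x p := by
  obtain ⟨c, hc⟩ := tilesAround_eq p d e hde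
  refine marked_of_reflexCorner (c := c) ?_ (by simp [hc]) hp x
  rw [IsReflexCorner, hc, Finset.insert_inter_of_mem hp, Finset.insert_inter_of_mem hd,
    Finset.insert_inter_of_mem he, Finset.singleton_inter_of_notMem h]
  have := d.vec_ne_zero
  have := e.vec_ne_zero
  have := Direction.vec_ne hde
  refine Finset.card_eq_three.2 ⟨_, _, _, ?_, ?_, ?_, rfl⟩ <;> simp_all

theorem isCornerPixel_of {B : Finset Pixel} {p : Pixel} {d e : Direction}
    (hde : d.axis ≠ e.axis) (hp : p ∈ B) (hd : p + d.vec ∉ B) (he : p + e.vec ∉ B) :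
    IsCornerPixel B p := by
  refine ⟨hp, ?_⟩
  cases d <;> cases e <;> first | exact absurd rfl hde | simp_all

/-- Walk along the segment in direction `e`. If it is unmarked, no reflex corner touches it, so the
side `d` stays missing up to the end. That end is then a corner pixel, hence included, and marks the
segment. -/
theorem marked_of_end {B S : Finset Pixel} {p : Pixel} {d e : Direction}
    (hde : d.axis ≠ e.axis) (hp : p ∈ B) (hd : p + d.vec ∉ B) : Marked B S e p := by
  by_contra hm
  have key : ¬ Marked B S e (tiltEnd B e p) ∧ tiltEnd B e p + d.vec ∉ B := by
    refine tilt_induction (P := fun z => ¬ Marked B S e z ∧ z + d.vec ∉ B) ?_ hp ⟨hm, hd⟩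
    rintro z hz hz' ⟨h1, h2⟩
    refine ⟨fun h => h1 (h.congr (tiltEnd_step hz hz')), fun h => h1 ?_⟩
    exact marked_of_missing_side hde hz h2 hz' (by rwa [add_right_comm]) e
  have hc : IsCornerPixel B (tiltEnd B e p) :=
    isCornerPixel_of hde (tiltEnd_mem e hp) key.2 (tiltEnd_add_notMem e hp)
  exact hm (marked_of_included_tiltEnd hp (.inl ⟨_, hc, .refl⟩))

/-- Any difference in shape between an unmarked segment and its neighbour would create a reflex
corner at `p`, which would mark the segment. -/
theorem band {B S : Finset Pixel} {p : Pixel} {d e : Direction} (hde : d.axis ≠ e.axis)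
    (hp : p ∈ B) (hd : p + d.vec ∈ B) (hm : ¬ Marked B S e p) {f : Direction}
    (hf : f.axis = e.axis) : p + f.vec ∈ B ↔ p + d.vec + f.vec ∈ B := by
  have hdf : d.axis ≠ f.axis := by rwa [hf]
  constructor
  · intro h
    by_contra h'
    exact hm (marked_of_missing_diagonal hdf hp hd h h' e)
  · intro h
    by_contra h'
    exact hm (marked_of_missing_side hdf.symm hp h' hd (by rwa [add_right_comm]) e)

/-! ### The vertex set of the large tilt graph -/

theorem mem_largeTiltVerts {B S : Finset Pixel} {p : Pixel} :
    p ∈ largeTiltVerts B S ↔ p ∈ B ∧ Marked B S .right p ∧ Marked B S .up p := by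
  simp only [largeTiltVerts, Finset.mem_filter, sameRowSegment_iff, sameColumnSegment_iff]
  constructor
  · rintro ⟨hp, h | ⟨⟨a, ha, _, ha', h1⟩, b, hb, _, hb', h2⟩⟩
    · exact ⟨hp, ⟨p, hp, h, rfl⟩, ⟨p, hp, h, rfl⟩⟩
    · exact ⟨hp, ⟨a, ha', ha, h1.symm⟩, ⟨b, hb', hb, h2.symm⟩⟩
  · rintro ⟨hp, ⟨a, ha', ha, h1⟩, ⟨b, hb', hb, h2⟩⟩
    exact ⟨hp, .inr ⟨⟨a, ha, hp, ha', h1.symm⟩, b, hb, hp, hb', h2.symm⟩⟩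

theorem subset_largeTiltVerts {B S : Finset Pixel} (hS : S ⊆ B) : S ⊆ largeTiltVerts B S :=
  fun s hs => mem_largeTiltVerts.2
    ⟨hS hs, ⟨s, hS hs, .inr (.inl hs), rfl⟩, ⟨s, hS hs, .inr (.inl hs), rfl⟩⟩

/-- Along the axis of `d` the segment does not change; the perpendicular segment at the end is
marked by `marked_of_end`. -/
theorem tiltEnd_mem_largeTiltVerts {B S : Finset Pixel} {p : Pixel}
    (hp : p ∈ largeTiltVerts B S) (d : Direction) : tiltEnd B d p ∈ largeTiltVerts B S := by
  obtain ⟨hB, h1, h2⟩ := mem_largeTiltVerts.1 hp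
  have hm := tiltEnd_mem d hB
  have hn := tiltEnd_add_notMem d hB
  refine mem_largeTiltVerts.2 ⟨hm, ?_, ?_⟩
  · by_cases hd : d.axis = Direction.right.axis
    · exact h1.congr (tiltEnd_tiltEnd_of_axis hd hB).symm
    · exact marked_of_end hd hm hn
  · by_cases hd : d.axis = Direction.up.axis
    · exact h2.congr (tiltEnd_tiltEnd_of_axis hd hB).symm
    · exact marked_of_end hd hm hn

/-! ### Snapping pixels to the large tilt graph -/

open Classical in
/-- Walk at most `n` pixels in direction `d`, up to the first pixel with a marked segment in
direction `e`. -/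
noncomputable def snapAux (B S : Finset Pixel) (d e : Direction) : ℕ → Pixel → Pixel
  | 0, p => p
  | n + 1, p => if Marked B S e p then p else snapAux B S d e n (p + d.vec)

/-- The first pixel in direction `d` from `p` that has a marked segment in direction `e`. -/
noncomputable def snap (B S : Finset Pixel) (d e : Direction) (p : Pixel) : Pixel :=
  snapAux B S d e (tiltDist B d p) p

theorem snap_of_marked {B S : Finset Pixel} {d e : Direction} {p : Pixel}
    (h : Marked B S e p) : snap B S d e p = p := by
  unfold snap
  cases tiltDist B d p <;> simp [snapAux, h]

theorem snap_of_not_marked {B S : Finset Pixel} {d e : Direction} {p : Pixel} (hp : p ∈ B)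
    (hd : p + d.vec ∈ B) (h : ¬ Marked B S e p) :
    snap B S d e p = snap B S d e (p + d.vec) := by
  rw [snap, tiltDist_step hp hd, snapAux, if_neg h, snap]

/-- Induction on the distance to the end in direction `d`: by `marked_of_end` a pixel with an
unmarked segment cannot be that end, so the walk always has a next pixel. -/
theorem snap_induction {B S : Finset Pixel} {d e : Direction} (hde : d.axis ≠ e.axis)
    {P : Pixel → Prop} (h1 : ∀ p ∈ B, Marked B S e p → P p)
    (h2 : ∀ p ∈ B, p + d.vec ∈ B → ¬ Marked B S e p → P (p + d.vec) → P p) :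
    ∀ p ∈ B, P p := by
  suffices ∀ n, ∀ p ∈ B, tiltDist B d p = n → P p from fun p hp => this _ p hp rfl
  intro n
  induction n with
  | zero =>
    intro p hp hn
    refine h1 p hp (marked_of_end hde hp fun h => ?_)
    have := tiltDist_step hp h
    omega
  | succ n ih =>
    intro p hp hn
    by_cases hm : Marked B S e p
    · exact h1 p hp hm
    · have hd : p + d.vec ∈ B := by
        by_contra h
        exact hm (marked_of_end hde hp h)
      have := tiltDist_step hp hd
      exact h2 p hp hd hm (ih _ hd (by omega))

theorem snap_spec {B S : Finset Pixel} {d e : Direction} (hde : d.axis ≠ e.axis) :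
    ∀ p ∈ B, snap B S d e p ∈ B ∧ Marked B S e (snap B S d e p) ∧
      tiltEnd B d (snap B S d e p) = tiltEnd B d p := by
  refine snap_induction (S := S) hde ?_ ?_
  · intro p hp hm
    rw [snap_of_marked hm]
    exact ⟨hp, hm, rfl⟩
  · intro p hp hd hm h
    rwa [snap_of_not_marked hp hd hm, ← tiltEnd_step hp hd]

/-- By `band`, all pixels of an unmarked segment can advance together, so the walk translates the
segment as a whole. -/
theorem snap_step {B S : Finset Pixel} {d e f : Direction} (hde : d.axis ≠ e.axis)
    (hf : f.axis = e.axis) :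
    ∀ p ∈ B, p + f.vec ∈ B → snap B S d e (p + f.vec) = snap B S d e p + f.vec := by
  refine snap_induction (S := S) hde ?_ ?_
  · intro p hp hm hpf
    rw [snap_of_marked hm, snap_of_marked (hm.congr (tiltEnd_step_of_axis hf hp hpf).symm)]
  · intro p hp hd hm ih hpf
    have h1 := (band hde hp hd hm hf).1 hpf
    rw [snap_of_not_marked hp hd hm, ← ih h1, add_right_comm]
    rw [snap_of_not_marked hpf (by rwa [add_right_comm])]
    exact fun h => hm (h.congr (tiltEnd_step_of_axis hf hp hpf))

theorem snap_add_notMem {B S : Finset Pixel} {d e f : Direction} (hde : d.axis ≠ e.axis)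
    (hf : f.axis = e.axis) :
    ∀ p ∈ B, p + f.vec ∉ B → snap B S d e p + f.vec ∉ B := by
  refine snap_induction (S := S) hde ?_ ?_
  · intro p hp hm h
    rwa [snap_of_marked hm]
  · intro p hp hd hm ih h
    rw [snap_of_not_marked hp hd hm]
    exact ih fun h' => h ((band hde hp hd hm hf).2 h')

theorem tiltEnd_snap_congr {B S : Finset Pixel} {d e : Direction} (hde : d.axis ≠ e.axis)
    {p q : Pixel} (hp : p ∈ B) (hq : q ∈ B) (h : tiltEnd B e p = tiltEnd B e q) :
    tiltEnd B e (snap B S d e p) = tiltEnd B e (snap B S d e q) := by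
  have key : ∀ p ∈ B, tiltEnd B e (snap B S d e (tiltEnd B e p)) =
      tiltEnd B e (snap B S d e p) := by
    intro p hp
    refine tilt_induction (P := fun z => tiltEnd B e (snap B S d e z) =
      tiltEnd B e (snap B S d e p)) ?_ hp rfl
    intro z hz hz' ih
    have h1 := snap_step (S := S) hde rfl z hz hz'
    rw [h1, tiltEnd_step (snap_spec hde z hz).1 (h1 ▸ (snap_spec hde _ hz').1), ih]
  rw [← key p hp, ← key q hq, h]

/-- The vertex of the large tilt graph that represents the pixel `p`. -/
noncomputable def rep (B S : Finset Pixel) (p : Pixel) : Pixel :=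
  snap B S .down .right (snap B S .left .up p)

theorem rep_mem {B S : Finset Pixel} {p : Pixel} (hp : p ∈ B) :
    rep B S p ∈ largeTiltVerts B S := by
  obtain ⟨h1, h2, -⟩ := snap_spec (S := S) (d := .left) (e := .up) (by decide) p hp
  obtain ⟨h4, h5, h6⟩ := snap_spec (S := S) (d := .down) (e := .right) (by decide) _ h1
  exact mem_largeTiltVerts.2
    ⟨h4, h5, h2.congr (tiltEnd_axis_congr (d := .down) (e := .up) rfl h1 h4 h6.symm)⟩

theorem rep_of_mem {B S : Finset Pixel} {p : Pixel}
    (hp : p ∈ largeTiltVerts B S) : rep B S p = p := by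
  obtain ⟨-, h1, h2⟩ := mem_largeTiltVerts.1 hp
  rw [rep, snap_of_marked h2, snap_of_marked h1]

/-- Each of the two snaps moves within segments of its own axis and, by `tiltEnd_snap_congr`,
carries segments of the other axis to segments. -/
theorem tiltEnd_rep_congr {B S : Finset Pixel} {p q : Pixel} (hp : p ∈ B)
    (hq : q ∈ B) {d : Direction} (h : tiltEnd B d p = tiltEnd B d q) :
    tiltEnd B d (rep B S p) = tiltEnd B d (rep B S q) := by
  obtain ⟨p1, -, p2⟩ := snap_spec (S := S) (d := .left) (e := .up) (by decide) p hp
  obtain ⟨p3, -, p4⟩ := snap_spec (S := S) (d := .down) (e := .right) (by decide) _ p1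
  obtain ⟨q1, -, q2⟩ := snap_spec (S := S) (d := .left) (e := .up) (by decide) q hq
  obtain ⟨q3, -, q4⟩ := snap_spec (S := S) (d := .down) (e := .right) (by decide) _ q1
  by_cases hd : d.axis = .right
  · have h1 := tiltEnd_axis_congr (e := .left) hd hp hq h
    rw [← p2, ← q2] at h1
    exact tiltEnd_axis_congr (d := .right) (e := d) hd.symm p3 q3 (tiltEnd_snap_congr (by decide) p1 q1
      (tiltEnd_axis_congr (d := .left) (e := .right) rfl p1 q1 h1))
  · replace hd : d.axis = .up := by cases d <;> simp_all [Direction.axis]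
    have h1 := tiltEnd_snap_congr (S := S) (d := .left) (by decide) hp hq
      (tiltEnd_axis_congr (e := .up) hd hp hq h)
    have h2 := tiltEnd_axis_congr (d := .up) (e := .down) rfl p1 q1 h1
    rw [← p4, ← q4] at h2
    exact tiltEnd_axis_congr (d := .down) (e := d) hd.symm p3 q3 h2

/-- When the neighbour in direction `d` is missing, the perpendicular segment is marked, so the snap
along the axis of `d` does nothing. The other snap preserves the missing neighbour. -/
theorem rep_add_notMem {B S : Finset Pixel} {p : Pixel} (hp : p ∈ B) {d : Direction}
    (h : p + d.vec ∉ B) : rep B S p + d.vec ∉ B := by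
  by_cases hd : d.axis = .right
  · rw [rep, snap_of_marked (marked_of_end (by rw [hd]; decide) hp h)]
    exact snap_add_notMem (by decide) hd p hp h
  · replace hd : d.axis = .up := by cases d <;> simp_all [Direction.axis]
    have hm : Marked B S .right p := marked_of_end (by rw [hd]; decide) hp h
    obtain ⟨p1, -, p2⟩ := snap_spec (S := S) (d := .left) (e := .up) (by decide) p hp
    rw [rep, snap_of_marked (d := .down)
      (hm.congr (tiltEnd_axis_congr (d := .left) (e := .right) rfl hp p1 p2.symm))]
    exact snap_add_notMem (by decide) hd p hp h

/-! ### Arborescences with few inverse edges -/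

open Relation in
/-- If every vertex of `V` reaches `T` along `E` and the edges of `I` with keys in `A`, then one
edge of `I` per key suffices, provided that the tails of edges with equal keys are joined by
`E`. -/
theorem exists_few_edges {α K : Type*} [DecidableEq α] [DecidableEq K] (I : Set (α × α))
    (key : α × α → K) (T : Set α) (V : Set α) (A : Finset K) :
    ∀ E : α → α → Prop,
      (∀ e ∈ I, ∀ f ∈ I, key e = key f → E e.1 f.1) →
      (∀ v ∈ V, ∃ t ∈ T, ReflTransGen (fun a b => E a b ∨ ((a, b) ∈ I ∧ key (a, b) ∈ A)) v t) →
      ∃ F : Finset (α × α), (∀ e ∈ F, e ∈ I) ∧ F.card ≤ A.card ∧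
        ∀ v ∈ V, ∃ t ∈ T, ReflTransGen (fun a b => E a b ∨ (a, b) ∈ F) v t := by
  -- `E` stays quantified because each round adds the chosen edge to it.
  induction hn : A.card generalizing A with
  | zero =>
    intro E _ h
    obtain rfl := Finset.card_eq_zero.1 hn
    exact ⟨∅, by simp, by simp, by simpa using h⟩
  | succ n ih =>
    intro E hE h
    by_cases hall : ∀ v ∈ V, ∃ t ∈ T, ReflTransGen E v t
    · exact ⟨∅, by simp, by simp, by simpa using hall⟩
    push Not at hall
    obtain ⟨v, hv, hvE⟩ := hall
    obtain ⟨t, ht, hvt⟩ := h v hv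
    -- On a path from `v` to `T`, which must use an edge of `I`, take the last such edge: from its
    -- head on, `E` alone suffices.
    have hlast : ∃ q p, (q, p) ∈ I ∧ key (q, p) ∈ A ∧ ∃ t ∈ T, ReflTransGen E p t := by
      by_contra hcon
      have : ∃ t ∈ T, ReflTransGen E v t := by
        clear hvE hv
        induction hvt using ReflTransGen.head_induction_on with
        | refl => exact ⟨t, ht, .refl⟩
        | @head a c hac _ ih =>
          obtain ⟨t', ht', hc⟩ := ih
          rcases hac with hac | hac
          · exact ⟨t', ht', .head hac hc⟩
          · exact absurd ⟨a, c, hac.1, hac.2, t', ht', hc⟩ hcon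
      obtain ⟨t', ht', h'⟩ := this
      exact hvE t' ht' h'
    obtain ⟨q, p, hqp, hA, t₀, ht₀, hpt⟩ := hlast
    obtain ⟨F, hF1, hF2, hF3⟩ := ih (A.erase (key (q, p)))
      (by rw [Finset.card_erase_of_mem hA, hn]; rfl)
      (fun a b => E a b ∨ (a, b) = (q, p)) (fun e he f hf hk => .inl (hE e he f hf hk)) (by
        intro w hw
        obtain ⟨s, hs, hws⟩ := h w hw
        clear hw
        induction hws using ReflTransGen.head_induction_on with
        | refl => exact ⟨s, hs, .refl⟩
        | @head a c hac _ ih' =>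
          obtain ⟨t', ht', hc⟩ := ih'
          rcases hac with hac | ⟨h1, h2⟩
          · exact ⟨t', ht', .head (.inl (.inl hac)) hc⟩
          -- At another edge with the chosen key, the path is abandoned: its tail is joined by `E`
          -- to `q`, and `(q, p)` leads on to `t₀`. So this key is no longer needed.
          · by_cases hk : key (a, c) = key (q, p)
            · refine ⟨t₀, ht₀, .head (.inl (.inl (hE _ h1 _ hqp hk))) (.head (.inl (.inr rfl)) ?_)⟩
              exact ReflTransGen.mono (fun x y hxy => .inl (.inl hxy)) _ _ hpt
            · exact ⟨t', ht', .head (.inr ⟨h1, Finset.mem_erase.2 ⟨hk, h2⟩⟩) hc⟩)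
    refine ⟨insert (q, p) F, ?_, ?_, ?_⟩
    · intro e he
      rcases Finset.mem_insert.1 he with rfl | he
      · exact hqp
      · exact hF1 e he
    · exact (Finset.card_insert_le _ _).trans (by omega)
    · intro w hw
      obtain ⟨s, hs, hws⟩ := hF3 w hw
      refine ⟨s, hs, ReflTransGen.mono ?_ _ _ hws⟩
      rintro x y ((hxy | hxy) | hxy)
      · exact .inl hxy
      · exact .inr (by simp [hxy])
      · exact .inr (Finset.mem_insert_of_mem hxy)

/-- `r` can be reached from `v` along `R` in at most `n` steps. -/
def ReachesWithin {α : Type*} (R : α → α → Prop) (r : α) : ℕ → α → Prop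
  | 0, v => v = r
  | n + 1, v => v = r ∨ ∃ w, R v w ∧ ReachesWithin R r n w

/-- A choice of next vertices on shortest paths to `r`. -/
theorem exists_next {α : Type*} (R : α → α → Prop) (r : α) (V : Set α)
    (hV : ∀ v ∈ V, Relation.ReflTransGen R v r) (hR : ∀ v ∈ V, ∀ w, R v w → w = r ∨ w ∈ V)
    (hr : r ∉ V) :
    ∃ f : α → α, (∀ v ∈ V, R v (f v)) ∧
      ∀ v ∈ V, Relation.ReflTransGen (fun a b => a ∈ V ∧ b = f a) v r := by
  classical
  have hex : ∀ v, Relation.ReflTransGen R v r → ∃ n, ReachesWithin R r n v := by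
    intro v hv
    induction hv using Relation.ReflTransGen.head_induction_on with
    | refl => exact ⟨0, rfl⟩
    | head h _ ih =>
      obtain ⟨n, hn⟩ := ih
      exact ⟨n + 1, .inr ⟨_, h, hn⟩⟩
  let d : α → ℕ := fun v => sInf {n | ReachesWithin R r n v}
  have hd : ∀ v ∈ V, ReachesWithin R r (d v) v := fun v hv => Nat.sInf_mem (hex v (hV v hv))
  have hnext : ∀ v ∈ V, ∃ w, R v w ∧ (w = r ∨ d w < d v) := by
    intro v hv
    have h := hd v hv
    rcases hn : d v with _ | n
    · rw [hn] at h
      exact absurd (h ▸ hv) hr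
    · rw [hn] at h
      rcases h with h | ⟨w, hw, h⟩
      · exact absurd (h ▸ hv) hr
      · exact ⟨w, hw, .inr (Nat.lt_succ_of_le (Nat.sInf_le h))⟩
  choose! f hf using hnext
  refine ⟨f, fun v hv => (hf v hv).1, ?_⟩
  suffices ∀ n, ∀ v ∈ V, d v = n → Relation.ReflTransGen (fun a b => a ∈ V ∧ b = f a) v r from
    fun v hv => this _ v hv rfl
  intro n
  induction n using Nat.strong_induction_on with
  | _ n ih =>
    rintro v hv rfl
    obtain ⟨h1, h2⟩ := hf v hv
    refine .head ⟨hv, rfl⟩ ?_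
    rcases hR v hv _ h1 with h | h
    · rw [h]
    · rcases h2 with h2 | h2
      · rw [h2]
      · exact ih _ h2 _ h rfl

namespace FinDigraph

theorem mem_inverseEdges {α : Type} [DecidableEq α] {G : FinDigraph α} {e : α × α} :
    e ∈ G.inverseEdges ↔ (e.2, e.1) ∈ G.edges ∧ e ∉ G.edges := by
  simp only [inverseEdges, Finset.mem_filter, Finset.mem_image]
  constructor
  · rintro ⟨⟨f, hf, rfl⟩, h⟩
    exact ⟨hf, h⟩
  · rintro ⟨h1, h2⟩
    exact ⟨⟨_, h1, rfl⟩, h2⟩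

theorem mem_verts_of_mem_edges {α : Type} {G : FinDigraph α} {a b : α} (h : (a, b) ∈ G.edges) :
    a ∈ G.verts ∧ b ∈ G.verts :=
  Finset.mem_product.1 (G.edges_subset h)

theorem totalWeight_eq {α : Type} [DecidableEq α] (G : FinDigraph α)
    (T : Finset (Option α × Option α)) :
    G.totalWeight T = (G.inverseEdges.filter (fun e => (some e.1, some e.2) ∈ T)).card := by
  simp only [totalWeight, extWeight]
  rw [Finset.sum_ite, Finset.sum_const_zero, add_zero, Finset.sum_const, smul_eq_mul, mul_one]
  symm
  refine Finset.card_bij (fun e _ => (some e.1, some e.2)) ?_ ?_ ?_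
  · intro e he
    obtain ⟨h1, h2⟩ := Finset.mem_filter.1 he
    exact Finset.mem_filter.2 ⟨h2, Finset.mem_image_of_mem _ h1⟩
  · rintro ⟨a, b⟩ _ ⟨c, d⟩ _ h
    simpa using h
  · intro e he
    obtain ⟨h1, h2⟩ := Finset.mem_filter.1 he
    obtain ⟨f, hf, rfl⟩ := Finset.mem_image.1 h2
    exact ⟨f, Finset.mem_filter.2 ⟨hf, h1⟩, rfl⟩

/-- An arborescence using only inverse edges from `F`. -/
theorem exists_arborescence {α : Type} [DecidableEq α] (G : FinDigraph α) (S : Finset α)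
    (F : Finset (α × α))
    (hF : ∀ e ∈ F, e ∈ G.inverseEdges)
    (h : ∀ v ∈ G.verts, ∃ s ∈ S,
      Relation.ReflTransGen (fun a b => (a, b) ∈ G.edges ∨ (a, b) ∈ F) v s) :
    ∃ T, G.IsArborescence S T ∧ G.totalWeight T ≤ F.card := by
  let X : Finset (Option α × Option α) :=
    (G.edges ∪ F).image (fun e => (some e.1, some e.2)) ∪ S.image (fun s => (some s, none))
  have hX : ∀ a b, (some a, b) ∈ X ↔
      (∃ c, b = some c ∧ ((a, c) ∈ G.edges ∨ (a, c) ∈ F)) ∨ (a ∈ S ∧ b = none) := by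
    intro a b
    simp only [X, Finset.mem_union, Finset.mem_image, Prod.mk.injEq, Option.some.injEq]
    constructor
    · rintro (⟨⟨x, y⟩, hxy, rfl, rfl⟩ | ⟨s, hs, rfl, rfl⟩)
      · exact .inl ⟨y, rfl, hxy⟩
      · exact .inr ⟨hs, rfl⟩
    · rintro (⟨c, rfl, hc⟩ | ⟨hs, rfl⟩)
      · exact .inl ⟨(a, c), hc, rfl, rfl⟩
      · exact .inr ⟨a, hs, rfl, rfl⟩
  -- Following shortest paths to the root gives each vertex one outgoing edge and excludes cycles.
  obtain ⟨f, hf1, hf2⟩ := exists_next (fun a b => (a, b) ∈ X) none (some '' (G.verts : Set α))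
    (by
      rintro _ ⟨v, hv, rfl⟩
      obtain ⟨s, hs, hvs⟩ := h v hv
      refine .tail (b := some s) ?_ ((hX _ _).2 (.inr ⟨hs, rfl⟩))
      exact hvs.lift some fun a b hab => (hX _ _).2 (.inl ⟨b, rfl, hab⟩))
    (by
      rintro _ ⟨v, hv, rfl⟩ w hw
      rcases (hX _ _).1 hw with ⟨c, rfl, hc | hc⟩ | ⟨-, rfl⟩
      · exact .inr ⟨c, (mem_verts_of_mem_edges hc).2, rfl⟩
      · exact .inr ⟨c, (mem_verts_of_mem_edges (mem_inverseEdges.1 (hF _ hc)).1).1, rfl⟩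
      · exact .inl rfl)
    (by simp)
  have hmem : ∀ a b, (a, b) ∈ G.verts.image (fun v => (some v, f (some v))) ↔
      ∃ v ∈ G.verts, a = some v ∧ b = f a := by
    intro a b
    simp only [Finset.mem_image, Prod.mk.injEq]
    constructor
    · rintro ⟨v, hv, rfl, rfl⟩
      exact ⟨v, hv, rfl, rfl⟩
    · rintro ⟨v, hv, rfl, rfl⟩
      exact ⟨v, hv, rfl, rfl⟩
  refine ⟨G.verts.image (fun v => (some v, f (some v))), ⟨?_, ?_, ?_⟩, ?_⟩
  · intro e he
    obtain ⟨v, hv, rfl⟩ := Finset.mem_image.1 he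
    have := hf1 (some v) ⟨v, hv, rfl⟩
    refine Finset.union_subset_union (Finset.image_subset_image ?_) subset_rfl this
    exact Finset.union_subset_union subset_rfl hF
  · intro v hv
    refine ⟨f (some v), (hmem _ _).2 ⟨v, hv, rfl, rfl⟩, fun w hw => ?_⟩
    obtain ⟨_, _, _, h⟩ := (hmem _ _).1 hw
    exact h
  · intro v hv
    refine Relation.ReflTransGen.mono ?_ _ _ (hf2 (some v) ⟨v, hv, rfl⟩)
    rintro a b ⟨⟨v, hv, rfl⟩, rfl⟩
    exact (hmem _ _).2 ⟨v, hv, rfl, rfl⟩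
  · rw [totalWeight_eq]
    refine Finset.card_le_card ?_
    rintro ⟨a, b⟩ he
    obtain ⟨h1, h2⟩ := Finset.mem_filter.1 he
    obtain ⟨v, hv, h3, h4⟩ := (hmem _ _).1 h2
    have := hf1 (some a) ⟨v, hv, h3.symm⟩
    rw [← h4] at this
    -- An inverse edge is not an edge of `G`, so if chosen it can only come from `F`.
    rcases (hX _ _).1 this with ⟨c, hc, h | h⟩ | ⟨-, h⟩
    · simp only [Option.some.injEq] at hc
      exact absurd (hc ▸ h) (mem_inverseEdges.1 h1).2
    · simp only [Option.some.injEq] at hc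
      exact hc ▸ h
    · cases h

end FinDigraph

/-! ### Draining single particles -/

/-- The foremost particle of the segment meets no obstruction and reaches its end. Particles are
indistinguishable here: only occupancy of the end matters, not which particle gets there. -/
theorem tiltEnd_mem_fullTilt {B C : Finset Pixel} (d : Direction) {p : Pixel} (hp : p ∈ B)
    (hC : p ∈ C) : tiltEnd B d p ∈ fullTilt B d C := by
  suffices ∀ n, ∀ p ∈ B, p ∈ C → tiltDist B d p = n → tiltEnd B d p ∈ fullTilt B d C from
    this _ p hp hC rfl
  intro n
  induction n using Nat.strong_induction_on with
  | _ n ih =>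
    rintro p hp hC rfl
    by_cases h : ∃ j, 1 ≤ j ∧ j ≤ tiltDist B d p ∧ p + j • d.vec ∈ C
    · obtain ⟨j, h1, h2, h3⟩ := h
      have hj : ∀ i ≤ j, p + i • d.vec ∈ B := fun i hi =>
        add_smul_mem_of_le_tiltDist d hp (hi.trans h2)
      have hd : tiltDist B d (p + j • d.vec) = tiltDist B d p - j := by
        refine tiltDist_eq (fun i hi => ?_) ?_
        · rw [add_assoc, ← add_nsmul]
          exact add_smul_mem_of_le_tiltDist d hp (by omega)
        · rw [add_assoc, ← add_nsmul, show j + (tiltDist B d p - j + 1) = tiltDist B d p + 1 by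
            omega]
          exact add_succ_tiltDist_notMem d hp
      rw [← tiltEnd_add_smul hj]
      exact ih _ (by omega) _ (hj j le_rfl) h3 rfl
    · push Not at h
      refine Finset.mem_image.2 ⟨p, hC, ?_⟩
      have : emptyAhead B d C p = tiltDist B d p := by
        rw [emptyAhead, Finset.filter_true_of_mem, Nat.card_Icc]
        · simp
        · intro j hj
          exact h j (Finset.mem_Icc.1 hj).1 (Finset.mem_Icc.1 hj).2
      rw [this, tiltEnd]

/-- If no sink pixel were reachable from `p` by single-particle tilts, some reachable pixel would
remain occupied after every move, so the board could never become empty. -/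
theorem Drainable.exists_reach {B : Finset Pixel} {sinks : Finset (Finset Pixel)}
    (h : Drainable B sinks) {p : Pixel} (hp : p ∈ B) :
    ∃ s ∈ sinks, ∃ q ∈ s,
      Relation.ReflTransGen (fun a b => a ∈ B ∧ ∃ d, b = tiltEnd B d a) p q := by
  by_contra hcon
  push Not at hcon
  have key : ∀ C, Relation.ReflTransGen (Move B sinks) B C → ∃ x ∈ C, x ∈ B ∧
      Relation.ReflTransGen (fun a b => a ∈ B ∧ ∃ d, b = tiltEnd B d a) p x := by
    intro C hC
    induction hC with
    | refl => exact ⟨p, hp, hp, .refl⟩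
    | tail _ hm ih =>
      obtain ⟨x, hxC, hxB, hx⟩ := ih
      cases hm with
      | tilt d => exact ⟨_, tiltEnd_mem_fullTilt d hxB hxC, tiltEnd_mem d hxB,
          hx.tail ⟨hxB, d, rfl⟩⟩
      | drain s hs =>
        exact ⟨x, Finset.mem_sdiff.2 ⟨hxC, fun hxs => hcon s hs x hxs hx⟩, hxB, hx⟩
  obtain ⟨x, hx, -⟩ := key ∅ h
  simp at hx

/-! ### The scaled board -/

/-- The pixel that contains a sub-pixel of the 3-scaled board. -/
def parent (x : Pixel) : Pixel := (x.1 / 3, x.2 / 3)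

theorem mem_subPixels {p x : Pixel} : x ∈ subPixels 3 p ↔ parent x = p := by
  obtain ⟨a, b⟩ := p
  obtain ⟨c, d⟩ := x
  simp only [subPixels, parent, Finset.mem_image, Finset.mem_product, Finset.mem_range,
    Prod.mk.injEq, Prod.exists]
  constructor
  · rintro ⟨i, j, ⟨hi, hj⟩, rfl, rfl⟩
    constructor <;> push_cast <;> omega
  · rintro ⟨h1, h2⟩
    refine ⟨(c - 3 * a).toNat, (d - 3 * b).toNat, ?_, ?_⟩ <;> push_cast <;> omega

theorem mem_scaledBoard {B : Finset Pixel} {x : Pixel} :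
    x ∈ scaledBoard 3 B ↔ parent x ∈ B := by
  simp [scaledBoard, mem_subPixels]

theorem parent_add_vec (x : Pixel) (d : Direction) :
    parent (x + d.vec) = parent x ∨ parent (x + d.vec) = parent x + d.vec := by
  obtain ⟨a, b⟩ := x
  cases d <;> simp only [parent, Direction.vec, Prod.mk_add_mk, Prod.mk.injEq] <;> omega

/-- A tilt on the 3-scaled board with obstacles `O` moves a particle within a segment, to the end
of the segment unless an obstacle lies in the segment. -/
theorem parent_tiltEnd {B O : Finset Pixel} {x : Pixel} (hx : x ∈ scaledBoard 3 B \ O)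
    (d : Direction) :
    parent (tiltEnd (scaledBoard 3 B \ O) d x) ∈ B ∧
      tiltEnd B d (parent (tiltEnd (scaledBoard 3 B \ O) d x)) = tiltEnd B d (parent x) ∧
      (parent (tiltEnd (scaledBoard 3 B \ O) d x) + d.vec ∉ B ∨
        ∃ o ∈ O, parent o ∈ B ∧ tiltEnd B d (parent o) = tiltEnd B d (parent x)) := by
  have hB : ∀ z ∈ scaledBoard 3 B \ O, parent z ∈ B := fun z hz =>
    mem_scaledBoard.1 (Finset.mem_sdiff.1 hz).1
  have hseg : tiltEnd B d (parent (tiltEnd (scaledBoard 3 B \ O) d x)) =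
      tiltEnd B d (parent x) := by
    refine tilt_induction (P := fun z => tiltEnd B d (parent z) = tiltEnd B d (parent x)) ?_ hx rfl
    intro z hz hz' ih
    rcases parent_add_vec z d with h | h
    · rw [h, ih]
    · rw [h, tiltEnd_step (hB z hz) (h ▸ hB _ hz'), ih]
  have hy := hB _ (tiltEnd_mem d hx)
  refine ⟨hy, hseg, ?_⟩
  have hn := tiltEnd_add_notMem d hx
  set y := tiltEnd (scaledBoard 3 B \ O) d x
  by_cases hyd : parent (y + d.vec) ∈ B
  · right
    -- The next sub-pixel belongs to the scaled board, so only an obstacle can have stopped the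
    -- particle.
    have hO : y + d.vec ∈ O := by
      by_contra h
      exact hn (Finset.mem_sdiff.2 ⟨mem_scaledBoard.2 hyd, h⟩)
    refine ⟨_, hO, hyd, ?_⟩
    rcases parent_add_vec y d with h | h
    · rw [h, hseg]
    · rw [h, tiltEnd_step hy (h ▸ hyd), hseg]
  · left
    rcases parent_add_vec y d with h | h
    · exact absurd (h ▸ hy) hyd
    · rwa [h] at hyd

/-! ### The lower bound -/

theorem mem_largeTiltGraph_edges {B S : Finset Pixel} {a b : Pixel} :
    (a, b) ∈ (largeTiltGraph B S).edges ↔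
      a ∈ largeTiltVerts B S ∧ ∃ d, b = tiltEnd B d a := by
  simp only [largeTiltGraph, FinDigraph.induce, fullTiltGraph, Finset.mem_filter,
    Finset.mem_product]
  constructor
  · rintro ⟨⟨-, h⟩, h', -⟩
    exact ⟨h', h⟩
  · rintro ⟨ha, d, rfl⟩
    have hB := (mem_largeTiltVerts.1 ha).1
    exact ⟨⟨⟨hB, tiltEnd_mem d hB⟩, d, rfl⟩, ha, tiltEnd_mem_largeTiltVerts ha d⟩

theorem largeTiltGraph_verts {B S : Finset Pixel} :
    (largeTiltGraph B S).verts = largeTiltVerts B S :=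
  Finset.inter_eq_right.2 fun _ hp => (mem_largeTiltVerts.1 hp).1

/-- The axis and the last pixel of the segment containing `p`. -/
def segKey (B : Finset Pixel) (d : Direction) (p : Pixel) : Direction × Pixel :=
  (d.axis, tiltEnd B d.axis p)

theorem axis_axis (d : Direction) : d.axis.axis = d.axis := by cases d <;> rfl

theorem segKey_eq_iff {B : Finset Pixel} {d : Direction} {p q : Pixel} (hp : p ∈ B) (hq : q ∈ B) :
    segKey B d p = segKey B d q ↔ tiltEnd B d p = tiltEnd B d q := by
  simp only [segKey, Prod.mk.injEq, true_and]
  exact ⟨tiltEnd_axis_congr (axis_axis d) hp hq, tiltEnd_axis_congr (axis_axis d).symm hp hq⟩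

/-- The key of the segment traversed by an edge. -/
def edgeKey (B : Finset Pixel) (e : Pixel × Pixel) : Direction × Pixel :=
  segKey B (if e.1.2 = e.2.2 then .right else .up) e.2

theorem edgeKey_tiltEnd {B : Finset Pixel} {d : Direction} {p : Pixel}
    (h : tiltEnd B d p ≠ p) : edgeKey B (tiltEnd B d p, p) = segKey B d p := by
  rw [tiltEnd] at h ⊢
  obtain ⟨a, b⟩ := p
  cases d <;> simp_all [edgeKey, segKey, Direction.vec, Direction.axis]

/-- The keys of the segments that represent the segments containing an obstacle. -/
noncomputable def blockedKeys (B S O : Finset Pixel) : Finset (Direction × Pixel) :=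
  O.image (fun o => segKey B .right (rep B S (parent o))) ∪
    O.image (fun o => segKey B .up (rep B S (parent o)))

theorem card_blockedKeys_le (B S O : Finset Pixel) : (blockedKeys B S O).card ≤ 2 * O.card := by
  refine (Finset.card_union_le _ _).trans ?_
  rw [two_mul]
  exact add_le_add Finset.card_image_le Finset.card_image_le

theorem segKey_mem_blockedKeys {B S O : Finset Pixel} {o : Pixel} (ho : o ∈ O) (d : Direction) :
    segKey B d (rep B S (parent o)) ∈ blockedKeys B S O := by
  cases d
  · exact Finset.mem_union_left _ (Finset.mem_image_of_mem _ ho)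
  · exact Finset.mem_union_left _ (Finset.mem_image_of_mem _ ho)
  · exact Finset.mem_union_right _ (Finset.mem_image_of_mem _ ho)
  · exact Finset.mem_union_right _ (Finset.mem_image_of_mem _ ho)

/-- The edges of the large tilt graph and the inverse edges along segments with keys in `A`. -/
def KeyedEdge (B S : Finset Pixel) (A : Finset (Direction × Pixel)) (a b : Pixel) : Prop :=
  (a, b) ∈ (largeTiltGraph B S).edges ∨
    ((a, b) ∈ {e | e ∈ (largeTiltGraph B S).inverseEdges} ∧ edgeKey B (a, b) ∈ A)

theorem keyedEdge_reach_tiltEnd {B S : Finset Pixel} {A : Finset (Direction × Pixel)} {a : Pixel}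
    (ha : a ∈ largeTiltVerts B S) (d : Direction) :
    Relation.ReflTransGen (KeyedEdge B S A) a (tiltEnd B d a) :=
  .single (.inl (mem_largeTiltGraph_edges.2 ⟨ha, d, rfl⟩))

/-- Go to the common end of the segment, then back to `b` along an edge or an inverse edge permitted
by the key. -/
theorem keyedEdge_reach_of_sameSegment {B S : Finset Pixel} {A : Finset (Direction × Pixel)}
    {a b : Pixel} (ha : a ∈ largeTiltVerts B S) (hb : b ∈ largeTiltVerts B S) {d : Direction}
    (h : tiltEnd B d a = tiltEnd B d b) (hA : segKey B d a ∈ A) :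
    Relation.ReflTransGen (KeyedEdge B S A) a b := by
  have hk := (segKey_eq_iff (mem_largeTiltVerts.1 ha).1 (mem_largeTiltVerts.1 hb).1).2 h
  refine (keyedEdge_reach_tiltEnd ha d).trans ?_
  rw [h]
  by_cases hbb : tiltEnd B d b = b
  · rw [hbb]
  refine .single ?_
  by_cases he : (tiltEnd B d b, b) ∈ (largeTiltGraph B S).edges
  · exact .inl he
  · refine .inr ⟨FinDigraph.mem_inverseEdges.2
      ⟨mem_largeTiltGraph_edges.2 ⟨hb, d, rfl⟩, he⟩, ?_⟩
    rwa [edgeKey_tiltEnd hbb, ← hk]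

/-- The tail of an inverse edge is an end of its segment, so a tilt from any pixel of the segment,
in particular from the other tail, leads to it. This is the hypothesis on tails in
`exists_few_edges`. -/
theorem edge_of_edgeKey_eq {B S : Finset Pixel} {e f : Pixel × Pixel}
    (he : e ∈ (largeTiltGraph B S).inverseEdges) (hf : f ∈ (largeTiltGraph B S).inverseEdges)
    (h : edgeKey B e = edgeKey B f) : (e.1, f.1) ∈ (largeTiltGraph B S).edges := by
  have key : ∀ e ∈ (largeTiltGraph B S).inverseEdges, e.1 ∈ largeTiltVerts B S ∧ e.2 ∈ B ∧
      ∃ d, e.1 = tiltEnd B d e.2 ∧ edgeKey B e = segKey B d e.2 := by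
    rintro ⟨a, b⟩ he
    obtain ⟨h1, h2⟩ := FinDigraph.mem_inverseEdges.1 he
    obtain ⟨h3, d, h4⟩ := mem_largeTiltGraph_edges.1 h1
    simp only at h4
    refine ⟨h4 ▸ tiltEnd_mem_largeTiltVerts h3 d, (mem_largeTiltVerts.1 h3).1, d, h4, ?_⟩
    rw [h4]
    refine edgeKey_tiltEnd fun h5 => h2 ?_
    rw [h4, h5] at h1 ⊢
    exact h1
  obtain ⟨e1, e2, d, e3, e4⟩ := key e he
  obtain ⟨-, f2, c, f3, f4⟩ := key f hf
  refine mem_largeTiltGraph_edges.2 ⟨e1, c, ?_⟩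
  rw [e4, f4] at h
  have hdc : d.axis = c.axis := congrArg Prod.fst h
  have h2 : tiltEnd B d.axis e.2 = tiltEnd B c.axis f.2 := congrArg Prod.snd h
  rw [hdc] at h2
  rw [e3, f3, tiltEnd_tiltEnd_of_axis hdc e2]
  exact (tiltEnd_axis_congr (axis_axis c) e2 f2 h2).symm

theorem keyedEdge_reach_of_tilt {B S O : Finset Pixel} {x : Pixel}
    (hx : x ∈ scaledBoard 3 B \ O) (d : Direction) :
    Relation.ReflTransGen (KeyedEdge B S (blockedKeys B S O)) (rep B S (parent x))
      (rep B S (parent (tiltEnd (scaledBoard 3 B \ O) d x))) := by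
  obtain ⟨hy, h1, h2⟩ := parent_tiltEnd hx d
  have hp : parent x ∈ B := mem_scaledBoard.1 (Finset.mem_sdiff.1 hx).1
  have h3 := tiltEnd_rep_congr (S := S) hy hp h1
  have hry := mem_largeTiltVerts.1 (rep_mem (S := S) hy)
  have hrp := mem_largeTiltVerts.1 (rep_mem (S := S) hp)
  rcases h2 with h2 | ⟨o, ho, hoB, h2⟩
  · have h4 := tiltEnd_of_notMem hry.1 (rep_add_notMem hy h2)
    rw [← h4, h3]
    exact keyedEdge_reach_tiltEnd (rep_mem hp) d
  · refine keyedEdge_reach_of_sameSegment (rep_mem hp) (rep_mem hy) h3.symm ?_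
    have h4 := tiltEnd_rep_congr (S := S) hoB hp h2
    rw [← (segKey_eq_iff (mem_largeTiltVerts.1 (rep_mem hoB)).1 hrp.1).2 h4]
    exact segKey_mem_blockedKeys ho d

/-- A particle starting in `p` follows tilts to a sink, and `rep` turns its route into a path in the
graph. The adjacency path to `s` serves the case in which the chosen starting sub-pixel is itself an
obstacle. -/
theorem keyedEdge_reach_sink {B S O : Finset Pixel} (hS : S ⊆ B)
    (hO : Drainable (scaledBoard 3 B \ O) (scaledSinks 3 S)) {p s : Pixel} (hp : p ∈ B)
    (hs : s ∈ S) (hps : Relation.ReflTransGen (Adj B) p s) :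
    ∃ t ∈ S, Relation.ReflTransGen (KeyedEdge B S (blockedKeys B S O)) (rep B S p) t := by
  have hrS : ∀ t ∈ S, rep B S t = t := fun t ht => rep_of_mem (subset_largeTiltVerts hS ht)
  induction hps using Relation.ReflTransGen.head_induction_on with
  | refl => exact ⟨s, hs, by rw [hrS s hs]⟩
  | @head p q hpq _ ih =>
    obtain ⟨-, hq, d, hd⟩ := hpq
    -- The lower-left sub-pixel; any sub-pixel of `p` would do.
    set x : Pixel := (3 * p.1, 3 * p.2) with hxdef
    have hxp : parent x = p := by simp [parent, hxdef]
    by_cases hx : x ∈ O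
    -- An obstacle in `p` blocks both segments of `p`, so movement along their images is
    -- unrestricted and the argument passes to the neighbour `q`.
    · obtain ⟨t, ht, hqt⟩ := ih hq
      refine ⟨t, ht, .trans ?_ hqt⟩
      have h1 : tiltEnd B d p = tiltEnd B d q := by
        rw [hd, tiltEnd_step hp (hd ▸ hq)]
      refine keyedEdge_reach_of_sameSegment (rep_mem hp) (rep_mem hq)
        (tiltEnd_rep_congr hp hq h1) ?_
      have := segKey_mem_blockedKeys (B := B) (S := S) hx d
      rwa [hxp] at this
    · have hx' : x ∈ scaledBoard 3 B \ O :=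
        Finset.mem_sdiff.2 ⟨mem_scaledBoard.2 (hxp.symm ▸ hp), hx⟩
      obtain ⟨u, hu, y, hy, hxy⟩ := hO.exists_reach hx'
      obtain ⟨t, ht, rfl⟩ := Finset.mem_image.1 hu
      refine ⟨t, ht, ?_⟩
      have key := Relation.ReflTransGen.lift'
        (p := KeyedEdge B S (blockedKeys B S O)) (fun z => rep B S (parent z))
        (fun a b hab => by
          obtain ⟨ha, e, rfl⟩ := hab
          exact keyedEdge_reach_of_tilt ha e) _ _ hxy
      change Relation.ReflTransGen _ (rep B S (parent x)) (rep B S (parent y)) at key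
      rwa [hxp, mem_subPixels.1 hy, hrS t ht] at key

theorem exists_arborescence_of_feasible {B S O : Finset Pixel} (hS : S ⊆ B)
    (hreg : EveryRegionHasSink B S) (hO : IsFeasible 3 B S O) :
    ∃ T, (largeTiltGraph B S).IsArborescence S T ∧
      (largeTiltGraph B S).totalWeight T ≤ 2 * O.card := by
  obtain ⟨F, hF1, hF2, hF3⟩ := exists_few_edges {e | e ∈ (largeTiltGraph B S).inverseEdges}
    (edgeKey B) (S : Set Pixel) (largeTiltVerts B S : Set Pixel) (blockedKeys B S O)
    (fun a b => (a, b) ∈ (largeTiltGraph B S).edges)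
    (fun e he f hf h => edge_of_edgeKey_eq he hf h) (by
      intro v hv
      have hB := (mem_largeTiltVerts.1 hv).1
      obtain ⟨s, hs, hvs⟩ := hreg v hB
      have := keyedEdge_reach_sink hS hO.2 hB hs hvs
      rwa [rep_of_mem hv] at this)
  obtain ⟨T, hT1, hT2⟩ := (largeTiltGraph B S).exists_arborescence S F hF1
    (by rw [largeTiltGraph_verts]; exact hF3)
  exact ⟨T, hT1, hT2.trans (hF2.trans (card_blockedKeys_le B S O))⟩

/-! ### Existence of a minimum arborescence and the size of the output -/

theorem exists_minArborescence {α : Type} [DecidableEq α] {G : FinDigraph α} {S : Finset α}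
    (h : ∃ T, G.IsArborescence S T) : ∃ T, G.IsMinArborescence S T := by
  have hw : (G.totalWeight '' {T | G.IsArborescence S T}).Nonempty := Set.Nonempty.image _ h
  obtain ⟨T, hT, hTw⟩ := Nat.sInf_mem hw
  exact ⟨T, hT, fun T' hT' => hTw.trans_le (Nat.sInf_le ⟨T', hT', rfl⟩)⟩

theorem card_turnGadget_le (e : Pixel × Pixel) : (turnGadget e).card ≤ 2 := by
  unfold turnGadget
  split_ifs <;> exact Finset.card_le_two

theorem card_placedObstacles_le (G : FinDigraph Pixel)
    (T : Finset (Option Pixel × Option Pixel)) :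
    (placedObstacles G T).card ≤ 2 * G.totalWeight T := by
  rw [G.totalWeight_eq, mul_comm]
  exact Finset.card_biUnion_le_card_mul _ _ _ fun e _ => card_turnGadget_le e

end TiltBoard

theorem mainTheorem2 (B S : Finset TiltBoard.Pixel) (hS : S ⊆ B)
    (hreg : TiltBoard.EveryRegionHasSink B S) :
    (∃ O : Finset TiltBoard.Pixel, TiltBoard.IsAlgorithmOutput B S O) ∧
    ∀ O : Finset TiltBoard.Pixel, TiltBoard.IsAlgorithmOutput B S O →
      O.card ≤ 4 * TiltBoard.optimum 3 B S := by
  obtain ⟨P, hP, hcard⟩ := TiltBoard.exists_optimum 3 B S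
  obtain ⟨T₀, hT₀, hw⟩ := TiltBoard.exists_arborescence_of_feasible hS hreg hP
  constructor
  · obtain ⟨T, hT⟩ := TiltBoard.exists_minArborescence ⟨T₀, hT₀⟩
    exact ⟨_, T, hT, rfl⟩
  · rintro _ ⟨T, hT, rfl⟩
    have h1 := TiltBoard.card_placedObstacles_le (TiltBoard.largeTiltGraph B S) T
    have h2 := hT.2 T₀ hT₀
    -- The output has at most twice the weight of `T`, which is at most the weight of `T₀`, which is
    -- at most `2 * P.card`.
    omega
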